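/- Let $d\in\{1,2,3\}$, let $\Omega\subset\mathbb R^d$ be a bounded domain (nonempty, open, connected) that is either convex (hence Lipschitz) or has a smooth boundary, let $V\in L^\infty(\Omega)$ with $V\ge 0$, let $\beta\ge 0$, and let $M_0\in\mathbb R$. For real-valued $u,z,w\in H_0^1(\Omega)$ put $$(z,w)_{a_0}=\int_\Omega \nabla z\cdot\nabla w+Vzw,\qquad (z,w)_{a_u}=\int_\Omega \nabla z\cdot\nabla w+Vzw+\beta|u|^2zw,\qquad E(u)=\int_\Omega |\nabla u|^2+V|u|^2+\tfrac{\beta}{2}|u|^4,$$ with induced norms $\|\cdot\|_{a_0}$, $\|\cdot\|_{a_u}$, and let $$\mathcal M=\{u\in H^1_0(\Omega):\ \|u\|_{L^2(\Omega)}=1,\ \|u\|_{L^\infty(\Omega)}\le M_0\},\qquad R(u)=u/\|u\|_{L^2}.$$ For $u\in\mathcal M$ let $\mathcal G_u u\in H_0^1(\Omega)$ be defined by $(z,\mathcal G_u u)_{a_u}=(z,u)_{L^2}$ for all $z\in H_0^1(\Omega)$. Let the Sobolev gradient $\nabla_{a_u}E(u)\in H^1_0(\Omega)$ be the element with $(\nabla_{a_u}E(u),w)_{a_u}=\frac12\frac{d}{dt}\big|_{t=0}E(u+tw)$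 for all $w\in H_0^1(\Omega)\cap L^\infty(\Omega)$ (with this normalization $\nabla_{a_u}E(u)=u$), and let the manifold gradient be its projection onto the tangent space, $$\operatorname{grad}E(u)=\nabla_{a_u}E(u)-\frac{(\nabla_{a_u}E(u),u)_{L^2}}{(\mathcal G_uu,\mathcal G_uu)_{a_u}}\,\mathcal G_uu .$$ Then there exist $\tau_{\max}>0$ and $C_D>0$, depending only on $\Omega,V,\beta,M_0$, such that for every sequence of step sizes with $0<\tau_n\le\tau_{\max}$ and every sequence $\{u_n\}_{n\ge0}\subset\mathcal M$ generated by the Sobolev projected gradient descent $$u_{n+1}=R\big(u_n-\tau_n\operatorname{grad}E(u_n)\big),\qquad n\ge 0,$$ the descent condition $$E(u_n)-E(u_{n+1})\ \ge\ C_D\,\|\operatorname{grad}E(u_n)\|_{a_{u_n}}\,\|u_n-u_{n+1}\|_{a_0}$$ holds for all $n\ge 0$. -/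

import Mathlib

open MeasureTheory
open scoped ContDiff Gradient

namespace GrossPitaevskii

noncomputable section

/-- The Euclidean space `ℝ^d`. -/
abbrev Euc (d : ℕ) : Type := EuclideanSpace ℝ (Fin d)

/-- `φ` is a smooth function with compact support contained in `Ω`. -/
def IsTestFunction {d : ℕ} (Ω : Set (Euc d)) (φ : Euc d → ℝ) : Prop :=
  ContDiff ℝ ∞ φ ∧ HasCompactSupport φ ∧ tsupport φ ⊆ Ω

/-- The ambient Hilbert space `L²(Ω) × L²(Ω; ℝ^d)`, with the Hilbert product norm. -/
abbrev L2Pair {d : ℕ} (Ω : Set (Euc d)) : Type :=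
  WithLp 2 (Lp ℝ 2 (volume.restrict Ω) × Lp (Euc d) 2 (volume.restrict Ω))

/-- The pairs `(φ, ∇φ)`, where `φ` is a test function on `Ω`. -/
def testPairs {d : ℕ} (Ω : Set (Euc d)) : Submodule ℝ (L2Pair Ω) where
  carrier := {p | ∃ φ : Euc d → ℝ, IsTestFunction Ω φ ∧
    p.fst =ᵐ[volume.restrict Ω] φ ∧ p.snd =ᵐ[volume.restrict Ω] fun x => ∇ φ x}
  zero_mem' := by
    refine ⟨fun _ => 0, ⟨contDiff_const, HasCompactSupport.zero, by simp [tsupport]⟩, ?_, ?_⟩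
    · exact Lp.coeFn_zero _ _ _
    · refine (Lp.coeFn_zero (Euc d) 2 (volume.restrict Ω)).trans (Filter.Eventually.of_forall ?_)
      intro x
      simp [gradient]
  add_mem' := by
    rintro p q ⟨φ, ⟨h1, h2, h3⟩, h4, h5⟩ ⟨ψ, ⟨k1, k2, k3⟩, k4, k5⟩
    refine ⟨φ + ψ, ⟨h1.add k1, h2.add k2,
      (tsupport_add φ ψ).trans (Set.union_subset h3 k3)⟩, ?_, ?_⟩
    · exact (Lp.coeFn_add p.fst q.fst).trans (h4.add k4)
    · refine (Lp.coeFn_add p.snd q.snd).trans ((h5.add k5).trans (Filter.Eventually.of_forall ?_))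
      intro x
      have e1 : DifferentiableAt ℝ φ x := (h1.differentiable (by simp)) x
      have e2 : DifferentiableAt ℝ ψ x := (k1.differentiable (by simp)) x
      simp [gradient, fderiv_add e1 e2]
  smul_mem' := by
    rintro c p ⟨φ, ⟨h1, h2, h3⟩, h4, h5⟩
    refine ⟨c • φ, ⟨h1.const_smul c, h2.mono (Function.support_const_smul_subset c φ),
      (closure_mono (Function.support_const_smul_subset c φ)).trans h3⟩, ?_, ?_⟩
    · exact (Lp.coeFn_smul c p.fst).trans (h4.const_smul c)
    · refine (Lp.coeFn_smul c p.snd).trans ((h5.const_smul c).trans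
        (Filter.Eventually.of_forall ?_))
      intro x
      have e1 : DifferentiableAt ℝ φ x := (h1.differentiable (by simp)) x
      simp [gradient, fderiv_const_smul e1 c]

/-- The real Sobolev space `H¹₀(Ω)`: the closure of the test functions in the `H¹` norm
`(‖u‖² + ‖∇u‖²)^{1/2}`. An element is a function `u ∈ L²(Ω)` together with its weak
gradient (see `weakGradient`). -/
def H10 {d : ℕ} (Ω : Set (Euc d)) : Submodule ℝ (L2Pair Ω) :=
  (testPairs Ω).topologicalClosure

variable {d : ℕ} {Ω : Set (Euc d)}

/-- The underlying function of an element of `H¹₀(Ω)`. -/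
def fn (u : H10 Ω) : Lp ℝ 2 (volume.restrict Ω) := u.1.fst

/-- The weak gradient of an element of `H¹₀(Ω)`. -/
def wgrad (u : H10 Ω) : Lp (Euc d) 2 (volume.restrict Ω) := u.1.snd

/-- `wgrad u` is the weak gradient of `fn u`. -/
theorem weakGradient (u : H10 Ω) {ψ : Euc d → ℝ} (hψ : IsTestFunction Ω ψ) (v : Euc d) :
    ∫ x in Ω, fn u x * fderiv ℝ ψ x v = -∫ x in Ω, inner ℝ (wgrad u x) v * ψ x := by
  obtain ⟨s1, s2, s3⟩ := hψ
  have sd : Differentiable ℝ ψ := s1.differentiable (by simp)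
  have sdc : Continuous fun x => fderiv ℝ ψ x v :=
    (s1.continuous_fderiv (by simp)).clm_apply continuous_const
  have sdk : HasCompactSupport fun x => fderiv ℝ ψ x v := s2.fderiv_apply ℝ v
  have m1 : MemLp (fun x => fderiv ℝ ψ x v) 2 (volume.restrict Ω) :=
    sdc.memLp_of_hasCompactSupport sdk
  have svk : HasCompactSupport fun x => ψ x • v := s2.smul_right
  have m2 : MemLp (fun x => ψ x • v) 2 (volume.restrict Ω) :=
    (s1.continuous.smul continuous_const).memLp_of_hasCompactSupport svk
  have key : ∀ p ∈ H10 Ω, inner ℝ (m1.toLp _) p.fst = -inner ℝ (m2.toLp _) p.snd := by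
    intro p hp
    have hc : IsClosed {p : L2Pair Ω |
        inner ℝ (m1.toLp _) p.fst = -inner ℝ (m2.toLp _) p.snd} := by
      refine isClosed_eq ?_ ?_
      · exact continuous_const.inner
          (continuous_fst.comp (WithLp.prod_continuous_ofLp 2 _ _))
      · exact (continuous_const.inner
          (continuous_snd.comp (WithLp.prod_continuous_ofLp 2 _ _))).neg
    refine closure_minimal ?_ hc hp
    rintro q ⟨φ, ⟨h1, h2, h3⟩, h4, h5⟩
    have hd : Differentiable ℝ φ := h1.differentiable (by simp)
    have hdc : Continuous fun x => fderiv ℝ φ x v :=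
      (h1.continuous_fderiv (by simp)).clm_apply continuous_const
    have a1 : inner ℝ (m1.toLp _) q.fst = ∫ x, φ x * fderiv ℝ ψ x v := by
      rw [L2.inner_def]
      rw [← setIntegral_eq_integral_of_forall_compl_eq_zero (s := Ω) (f := fun x => φ x * fderiv ℝ ψ x v)]
      · refine integral_congr_ae ?_
        filter_upwards [m1.coeFn_toLp, h4] with x y1 y2
        simp [y1, y2]
      · intro x hx
        rw [image_eq_zero_of_notMem_tsupport fun h => hx (h3 h), zero_mul]
    have a2 : inner ℝ (m2.toLp _) q.snd = ∫ x, fderiv ℝ φ x v * ψ x := by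
      rw [L2.inner_def]
      rw [← setIntegral_eq_integral_of_forall_compl_eq_zero (s := Ω) (f := fun x => fderiv ℝ φ x v * ψ x)]
      · refine integral_congr_ae ?_
        filter_upwards [m2.coeFn_toLp, h5] with x y1 y2
        rw [y1, y2, real_inner_smul_left, real_inner_comm, mul_comm]
        simp [gradient]
      · intro x hx
        rw [image_eq_zero_of_notMem_tsupport fun h => hx (s3 h), mul_zero]
    change inner ℝ (m1.toLp _) q.fst = -inner ℝ (m2.toLp _) q.snd
    rw [a1, a2]
    refine integral_mul_fderiv_eq_neg_fderiv_mul_of_integrable ?_ ?_ ?_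
      (fun x _ => hd x) (fun x _ => sd x)
    · exact (hdc.mul s1.continuous).integrable_of_hasCompactSupport s2.mul_left
    · exact (h1.continuous.mul sdc).integrable_of_hasCompactSupport sdk.mul_left
    · exact (h1.continuous.mul s1.continuous).integrable_of_hasCompactSupport s2.mul_left
  have e := key u.1 u.2
  rw [L2.inner_def, L2.inner_def] at e
  have b1 : ∫ x in Ω, fn u x * fderiv ℝ ψ x v
      = ∫ x in Ω, inner ℝ ((m1.toLp _ : Lp ℝ 2 (volume.restrict Ω)) x) (u.1.fst x) := by
    refine integral_congr_ae ?_
    filter_upwards [m1.coeFn_toLp] with x y1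
    simp [y1, fn]
  have b2 : ∫ x in Ω, inner ℝ (wgrad u x) v * ψ x
      = ∫ x in Ω, inner ℝ ((m2.toLp _ : Lp (Euc d) 2 (volume.restrict Ω)) x) (u.1.snd x) := by
    refine integral_congr_ae ?_
    filter_upwards [m2.coeFn_toLp] with x y1
    rw [y1, real_inner_smul_left, real_inner_comm, mul_comm]
    rfl
  rw [b1, b2, e]

/-- `Ω` has a smooth boundary: near each boundary point, `Ω` is the negativity set of a smooth
function whose differential does not vanish at that point. -/
def HasSmoothBoundary {d : ℕ} (Ω : Set (Euc d)) : Prop :=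
  ∀ x ∈ frontier Ω, ∃ r > 0, ∃ ρ : Euc d → ℝ, ContDiff ℝ ∞ ρ ∧ fderiv ℝ ρ x ≠ 0 ∧
    ∀ y ∈ Metric.ball x r, y ∈ Ω ↔ ρ y < 0

/-- The standing assumptions on the dimension `d`, the domain `Ω`, the potential `V` and the
interaction parameter `β`. A bounded convex domain is automatically Lipschitz. -/
structure Admissible (d : ℕ) (Ω : Set (Euc d)) (V : Euc d → ℝ) (β : ℝ) : Prop where
  dim : d = 1 ∨ d = 2 ∨ d = 3
  isOpen : IsOpen Ω
  isConnected : IsConnected Ω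
  isBounded : Bornology.IsBounded Ω
  boundary : Convex ℝ Ω ∨ HasSmoothBoundary Ω
  potential_memLp : MemLp V ⊤ (volume.restrict Ω)
  potential_nonneg : ∀ᵐ x ∂volume.restrict Ω, 0 ≤ V x
  beta_nonneg : 0 ≤ β

/-- The `L²(Ω)` inner product. -/
def l2Form (z w : H10 Ω) : ℝ := ∫ x in Ω, fn z x * fn w x

/-- The `L²(Ω)` norm. -/
def l2Norm (z : H10 Ω) : ℝ := Real.sqrt (l2Form z z)

/-- The inner product `(z, w)_{a₀} = ∫_Ω ∇z · ∇w + V z w`. -/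
def a0Form (V : Euc d → ℝ) (z w : H10 Ω) : ℝ :=
  ∫ x in Ω, (inner ℝ (wgrad z x) (wgrad w x) + V x * fn z x * fn w x)

/-- The norm `‖z‖_{a₀}`. -/
def a0Norm (V : Euc d → ℝ) (z : H10 Ω) : ℝ := Real.sqrt (a0Form V z z)

/-- The adaptive inner product `(z, w)_{a_u} = ∫_Ω ∇z · ∇w + V z w + β |u|² z w`. -/
def auForm (V : Euc d → ℝ) (β : ℝ) (u z w : H10 Ω) : ℝ :=
  ∫ x in Ω, (inner ℝ (wgrad z x) (wgrad w x) + V x * fn z x * fn w x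
    + β * |fn u x| ^ 2 * fn z x * fn w x)

/-- The norm `‖z‖_{a_u}`. -/
def auNorm (V : Euc d → ℝ) (β : ℝ) (u z : H10 Ω) : ℝ := Real.sqrt (auForm V β u z z)

/-- The energy `E(u) = ∫_Ω |∇u|² + V |u|² + (β/2) |u|⁴`. -/
def energy (V : Euc d → ℝ) (β : ℝ) (u : H10 Ω) : ℝ :=
  ∫ x in Ω, (‖wgrad u x‖ ^ 2 + V x * |fn u x| ^ 2 + β / 2 * |fn u x| ^ 4)

/-- The manifold of all `u ∈ H¹₀(Ω)` with `‖u‖_{L²} = 1` and `‖u‖_{L^∞} ≤ M₀`. -/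
def manifold (Ω : Set (Euc d)) (M₀ : ℝ) : Set (H10 Ω) :=
  {u | l2Norm u = 1 ∧ ∀ᵐ x ∂volume.restrict Ω, |fn u x| ≤ M₀}

/-- The retraction `R(u) = u / ‖u‖_{L²}`. -/
def retraction (u : H10 Ω) : H10 Ω := (l2Norm u)⁻¹ • u

/-- `y = 𝒢_u w`, that is, `(z, y)_{a_u} = (z, w)_{L²}` for all `z ∈ H¹₀(Ω)`. -/
def IsGreen (V : Euc d → ℝ) (β : ℝ) (u w y : H10 Ω) : Prop :=
  ∀ z : H10 Ω, auForm V β u z y = l2Form z w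

/-- The Green's function `𝒢_u` of the inner product `(·, ·)_{a_u}`. -/
def green (V : Euc d → ℝ) (β : ℝ) (u w : H10 Ω) : H10 Ω :=
  Classical.epsilon (IsGreen V β u w)

/-- `g` is the Sobolev gradient of the energy at `u` for the inner product `(·, ·)_{a_u}`: it
represents the derivative of the energy along all directions `w ∈ H¹₀(Ω) ∩ L^∞(Ω)`. The
normalization is `(∇E(u), w)_{L²} = (1/2) d/dt E(u + t w)` at `t = 0`, for which the Sobolev
gradient at `u` is `u` itself. -/
def IsSobolevGrad (V : Euc d → ℝ) (β : ℝ) (u g : H10 Ω) : Prop :=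
  ∀ w : H10 Ω, MemLp (fn w) ⊤ (volume.restrict Ω) →
    HasDerivAt (fun t : ℝ => energy V β (u + t • w)) (2 * auForm V β u g w) 0

/-- The Sobolev gradient `∇_{a_u} E(u)`. -/
def sobolevGrad (V : Euc d → ℝ) (β : ℝ) (u : H10 Ω) : H10 Ω :=
  Classical.epsilon (IsSobolevGrad V β u)

/-- The `a_u`-orthogonal projection onto the tangent space at `u`,
`P_u ξ = ξ - (ξ, u)_{L²} / (𝒢_u u, 𝒢_u u)_{a_u} 𝒢_u u`. -/
def tangentProj (V : Euc d → ℝ) (β : ℝ) (u ξ : H10 Ω) : H10 Ω :=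
  ξ - (l2Form ξ u / auForm V β u (green V β u u) (green V β u u)) • green V β u u

/-- The manifold gradient `grad E(u)`. -/
def manifoldGrad (V : Euc d → ℝ) (β : ℝ) (u : H10 Ω) : H10 Ω :=
  tangentProj V β u (sobolevGrad V β u)

/-- One step `u ↦ R(u - τ grad E(u))` of the Sobolev projected gradient descent. -/
def pgdStep (V : Euc d → ℝ) (β τ : ℝ) (u : H10 Ω) : H10 Ω :=
  retraction (u - τ • manifoldGrad V β u)

end

end GrossPitaevskii

namespace GrossPitaevskii

noncomputable section

variable {d : ℕ} {Ω : Set (Euc d)} {V : Euc d → ℝ} {β M₀ : ℝ}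

/-! Write `g = grad E(u)`, `w = R(u - τg)`, `G = ‖g‖_{a_u}`, `A = ‖u‖_{a_u}`, `N = ‖u - τg‖_{L²}`.
Since `g = u - α⁻¹ 𝒢_u u`, it is `L²`-orthogonal to `u`, and therefore `a_u`-orthogonal to `𝒢_u u`.
This gives `(u,g)_{a_u} = G²` and `N² = 1 + τ²‖g‖²`, so all quadratic quantities of the step become
explicit.

The energy is quadratic up to an error: `E(w) - E(u) = ‖w‖²_{a_u} - ‖u‖²_{a_u} + (β/2)∫(w² - u²)²`,
and the `L^∞` bounds control the last term by `2βM₀²‖w - u‖²_{L²}` (`energy_sub_le`). This is of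
order `τ²‖g‖²_{L²}`, which Poincaré (`exists_poincare`) bounds by `Cτ²G²`, so for small `τ` the
first-order gain `2τG²` absorbs it. What remains dominates half of `G‖u - w‖_{a_0}`
(`descent_inequality`).

The gradient and Green's function are chosen by `Classical.epsilon`, so their existence, and
uniqueness of the gradient, are proved through coercivity of the weighted forms. -/

/-! ### Poincaré inequality on a bounded domain -/

/-- Integration by parts of `x_i φ` against `φ` in direction `e_i`, using `∂_i x_i = 1`. -/
theorem IsTestFunction.integral_sq_eq {φ : Euc d → ℝ} (hφ : IsTestFunction Ω φ) (i : Fin d) :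
    ∫ x, φ x ^ 2 = -2 * ∫ x, x i * φ x * fderiv ℝ φ x (EuclideanSpace.single i 1) := by
  obtain ⟨h1, h2, -⟩ := hφ
  set v : Euc d := EuclideanSpace.single i 1 with hv
  have hd : Differentiable ℝ φ := h1.differentiable (by simp)
  have hc : Continuous φ := h1.continuous
  have hdc : Continuous fun x => fderiv ℝ φ x v :=
    (h1.continuous_fderiv (by simp)).clm_apply continuous_const
  have hp : ∀ x, HasFDerivAt (fun y : Euc d => y i)
      (EuclideanSpace.proj i : Euc d →L[ℝ] ℝ) x := fun x =>
    (EuclideanSpace.proj i : Euc d →L[ℝ] ℝ).hasFDerivAt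
  have hpc : Continuous fun y : Euc d => y i :=
    (EuclideanSpace.proj i : Euc d →L[ℝ] ℝ).continuous
  have hf : ∀ x, fderiv ℝ (fun y : Euc d => y i * φ y) x v
      = φ x + x i * fderiv ℝ φ x v := by
    intro x
    change fderiv ℝ ((fun y : Euc d => y i) * φ) x v = _
    rw [((hp x).mul (hd x).hasFDerivAt).fderiv]
    simp [hv]
    ring
  have i1 : Integrable fun x => φ x * φ x := (hc.mul hc).integrable_of_hasCompactSupport h2.mul_left
  have i2 : Integrable fun x => x i * φ x * fderiv ℝ φ x v :=
    ((hpc.mul hc).mul hdc).integrable_of_hasCompactSupport (h2.mul_left).mul_right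
  have i2' : Integrable fun x => x i * fderiv ℝ φ x v * φ x := by
    refine i2.congr (Filter.Eventually.of_forall fun x => ?_)
    ring
  have key := integral_mul_fderiv_eq_neg_fderiv_mul_of_integrable (μ := volume)
    (f := fun y : Euc d => y i * φ y) (g := φ) (v := v)
    (by
      refine (i1.add i2').congr (Filter.Eventually.of_forall fun x => ?_)
      simp only [Pi.add_apply, hf]
      ring)
    i2
    (((hpc.mul hc).mul hc).integrable_of_hasCompactSupport h2.mul_left)
    (fun x _ => (hp x).differentiableAt.mul (hd x)) (fun x _ => hd x)
  have e : ∫ x, fderiv ℝ (fun y : Euc d => y i * φ y) x v * φ x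
      = (∫ x, φ x ^ 2) + ∫ x, x i * φ x * fderiv ℝ φ x v := by
    rw [← integral_add (by simpa only [sq] using i1) i2]
    refine integral_congr_ae (Filter.Eventually.of_forall fun x => ?_)
    simp only [hf]
    ring
  rw [e] at key
  linarith

theorem integral_sq_eq_norm_sq {α F : Type*} [MeasurableSpace α] {μ : Measure α}
    [NormedAddCommGroup F] [InnerProductSpace ℝ F] (f : Lp F 2 μ) :
    ∫ x, ‖f x‖ ^ 2 ∂μ = ‖f‖ ^ 2 := by
  rw [← real_inner_self_eq_norm_sq, L2.inner_def]
  simp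

theorem poincare_of_mem_testPairs {R : ℝ} (hR : ∀ x ∈ Ω, ‖x‖ ≤ R) (hΩ : MeasurableSet Ω)
    (i : Fin d) {p : L2Pair Ω} (hp : p ∈ testPairs Ω) :
    ‖p.fst‖ ^ 2 ≤ 4 * R ^ 2 * ‖p.snd‖ ^ 2 := by
  obtain ⟨φ, hφ, e1, e2⟩ := hp
  have key := hφ.integral_sq_eq i
  obtain ⟨h1, h2, h3⟩ := hφ
  have z : ∀ x ∉ Ω, φ x = 0 := fun x hx => image_eq_zero_of_notMem_tsupport fun h => hx (h3 h)
  rw [← setIntegral_eq_integral_of_forall_compl_eq_zero (s := Ω) (fun x hx => by simp [z x hx]),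
    ← setIntegral_eq_integral_of_forall_compl_eq_zero (s := Ω) (f := fun x => _ * _ * _)
      (fun x hx => by simp [z x hx]), ← integral_const_mul] at key
  have a1 : ∫ x in Ω, φ x ^ 2 = ‖p.fst‖ ^ 2 := by
    rw [← integral_sq_eq_norm_sq]
    refine integral_congr_ae ?_
    filter_upwards [e1] with x hx
    simp [hx]
  have a2 : ∫ x in Ω, ‖∇ φ x‖ ^ 2 = ‖p.snd‖ ^ 2 := by
    rw [← integral_sq_eq_norm_sq]
    refine integral_congr_ae ?_
    filter_upwards [e2] with x hx
    simp [hx]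
  have i1 : Integrable (fun x => φ x ^ 2) (volume.restrict Ω) := by
    refine ((Lp.memLp p.fst).integrable_norm_pow (by norm_num)).congr ?_
    filter_upwards [e1] with x hx
    simp [hx]
  have i2 : Integrable (fun x => ‖∇ φ x‖ ^ 2) (volume.restrict Ω) := by
    refine ((Lp.memLp p.snd).integrable_norm_pow (by norm_num)).congr ?_
    filter_upwards [e2] with x hx
    simp [hx]
  have i3 : Integrable (fun x => x i * φ x * fderiv ℝ φ x (EuclideanSpace.single i 1))
      (volume.restrict Ω) := by
    have hpc : Continuous fun y : Euc d => y i :=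
      (EuclideanSpace.proj i : Euc d →L[ℝ] ℝ).continuous
    exact (((hpc.mul h1.continuous).mul ((h1.continuous_fderiv (by simp)).clm_apply
      continuous_const)).integrable_of_hasCompactSupport (h2.mul_left).mul_right).integrableOn
  have b : ∫ x in Ω, -2 * (x i * φ x * fderiv ℝ φ x (EuclideanSpace.single i 1))
      ≤ ∫ x in Ω, (1 / 2 * φ x ^ 2 + 2 * R ^ 2 * ‖∇ φ x‖ ^ 2) := by
    refine integral_mono_ae (i3.const_mul _) ((i1.const_mul _).add (i2.const_mul _)) ?_
    filter_upwards [ae_restrict_mem hΩ] with x hx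
    have b1 : |x i| ≤ R := (PiLp.norm_apply_le x i).trans (hR x hx)
    have b2 : |fderiv ℝ φ x (EuclideanSpace.single i 1)| ≤ ‖∇ φ x‖ := by
      have := (fderiv ℝ φ x).le_opNorm (EuclideanSpace.single i 1)
      simpa [gradient] using this
    have b3 : |x i * fderiv ℝ φ x (EuclideanSpace.single i 1)| ≤ R * ‖∇ φ x‖ := by
      rw [abs_mul]
      gcongr
      exact (abs_nonneg _).trans b1
    have b4 := sq_le_sq' (abs_le.1 b3).1 (abs_le.1 b3).2
    -- Young's inequality `-2sφ ≤ φ²/2 + 2s²` with `s = x_i ∂_i φ`; the term `φ²/2` is absorbed on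
    -- the left, whence the constant `4R²`.
    nlinarith [sq_nonneg (φ x + 2 * (x i * fderiv ℝ φ x (EuclideanSpace.single i 1)))]
  rw [← key, integral_add (i1.const_mul _) (i2.const_mul _), integral_const_mul, integral_const_mul,
    a1, a2] at b
  linarith

theorem exists_poincare (hadm : Admissible d Ω V β) :
    ∃ C > 0, ∀ p ∈ H10 Ω, ‖p.fst‖ ^ 2 ≤ C * ‖p.snd‖ ^ 2 := by
  obtain ⟨R, hR0, hR⟩ := hadm.isBounded.exists_pos_norm_le
  have i : Fin d := ⟨0, by have := hadm.dim; omega⟩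
  refine ⟨4 * R ^ 2, by positivity, fun p hp => ?_⟩
  have hc : IsClosed {p : L2Pair Ω | ‖p.fst‖ ^ 2 ≤ 4 * R ^ 2 * ‖p.snd‖ ^ 2} :=
    isClosed_le
      ((continuous_fst.comp (WithLp.prod_continuous_ofLp 2 _ _)).norm.pow 2)
      (((continuous_snd.comp (WithLp.prod_continuous_ofLp 2 _ _)).norm.pow 2).const_mul _)
  exact closure_minimal
    (fun q hq => poincare_of_mem_testPairs hR hadm.isOpen.measurableSet i hq) hc hp

/-! ### Weighted forms, coercivity and Lax–Milgram -/

/-- The bounded bilinear form `∫_Ω ∇z · ∇w + c z w` on the ambient space, for a bounded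
weight `c`. -/
def weightForm {c : Euc d → ℝ} (hc : MemLp c ⊤ (volume.restrict Ω)) :
    L2Pair Ω →L[ℝ] L2Pair Ω →L[ℝ] ℝ :=
  (innerSL ℝ).bilinearComp (WithLp.sndL 2 ℝ _ _) (WithLp.sndL 2 ℝ _ _) +
  (innerSL ℝ).bilinearComp
    ((((ContinuousLinearMap.mul ℝ ℝ).holderL (volume.restrict Ω) ⊤ 2 2) (hc.toLp c)).comp
      (WithLp.fstL 2 ℝ _ _)) (WithLp.fstL 2 ℝ _ _)

theorem integrable_weight_mul {c : Euc d → ℝ} (hc : MemLp c ⊤ (volume.restrict Ω))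
    (f g : Lp ℝ 2 (volume.restrict Ω)) :
    Integrable (fun x => c x * f x * g x) (volume.restrict Ω) := by
  have h : MemLp (fun x => c x * f x) 2 (volume.restrict Ω) := (Lp.memLp f).mul hc
  exact h.integrable_mul (Lp.memLp g)

theorem weightForm_apply {c : Euc d → ℝ} (hc : MemLp c ⊤ (volume.restrict Ω)) (p q : L2Pair Ω) :
    weightForm hc p q
      = ∫ x in Ω, (inner ℝ (p.snd x) (q.snd x) + c x * p.fst x * q.fst x) := by
  rw [integral_add (L2.integrable_inner _ _) (integrable_weight_mul hc _ _)]
  have e : weightForm hc p q = inner ℝ p.snd q.snd +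
      inner ℝ ((ContinuousLinearMap.mul ℝ ℝ).holder 2 (hc.toLp c) p.fst) q.fst := rfl
  rw [e, L2.inner_def, L2.inner_def]
  congr 1
  refine integral_congr_ae ?_
  filter_upwards [(ContinuousLinearMap.mul ℝ ℝ).coeFn_holder (r := 2) (hc.toLp c) p.fst,
    hc.coeFn_toLp] with x h1 h2
  rw [h1, h2]
  simp [mul_comm]

theorem weightForm_comm {c : Euc d → ℝ} (hc : MemLp c ⊤ (volume.restrict Ω)) (p q : L2Pair Ω) :
    weightForm hc p q = weightForm hc q p := by
  rw [weightForm_apply, weightForm_apply]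
  refine integral_congr_ae (Filter.Eventually.of_forall fun x => ?_)
  simp only [real_inner_comm (p.snd x) (q.snd x), mul_right_comm (c x) (p.fst x) (q.fst x)]

theorem norm_snd_sq_le_weightForm {c : Euc d → ℝ} (hc : MemLp c ⊤ (volume.restrict Ω))
    (h0 : ∀ᵐ x ∂volume.restrict Ω, 0 ≤ c x) (p : L2Pair Ω) :
    ‖p.snd‖ ^ 2 ≤ weightForm hc p p := by
  rw [weightForm_apply, ← integral_sq_eq_norm_sq]
  refine integral_mono_ae ((Lp.memLp p.snd).integrable_norm_pow (by norm_num))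
    ((L2.integrable_inner _ _).add (integrable_weight_mul hc _ _)) ?_
  filter_upwards [h0] with x hx
  rw [real_inner_self_eq_norm_sq]
  nlinarith [mul_nonneg hx (mul_self_nonneg (p.fst x))]

/-- A nonnegative weight only helps, so Poincaré alone gives a constant `κ` independent of the
weight. -/
theorem exists_coercive (hadm : Admissible d Ω V β) :
    ∃ κ > 0, ∀ p ∈ H10 Ω, ∀ (c : Euc d → ℝ) (hc : MemLp c ⊤ (volume.restrict Ω)),
      (∀ᵐ x ∂volume.restrict Ω, 0 ≤ c x) → κ * ‖p‖ ^ 2 ≤ weightForm hc p p := by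
  obtain ⟨C, hC, h⟩ := exists_poincare hadm
  refine ⟨(C + 1)⁻¹, by positivity, fun p hp c hc h0 => ?_⟩
  have h1 := norm_snd_sq_le_weightForm hc h0 p
  have h2 := h p hp
  rw [inv_mul_le_iff₀ (by positivity), WithLp.prod_norm_sq_eq_of_L2]
  nlinarith

/-- The Lax–Milgram theorem for `weightForm` on `H¹₀(Ω)`. -/
theorem exists_weightForm_eq_inner (hadm : Admissible d Ω V β) {c : Euc d → ℝ}
    (hc : MemLp c ⊤ (volume.restrict Ω)) (h0 : ∀ᵐ x ∂volume.restrict Ω, 0 ≤ c x)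
    (f : H10 Ω) : ∃ y : H10 Ω, ∀ z : H10 Ω, weightForm hc z y = l2Form z f := by
  obtain ⟨κ, hκ, hB⟩ := exists_coercive hadm
  have : CompleteSpace (H10 Ω) :=
    (Submodule.isClosed_topologicalClosure (testPairs Ω)).completeSpace_coe
  let B : H10 Ω →L[ℝ] H10 Ω →L[ℝ] ℝ :=
    (weightForm hc).bilinearComp (H10 Ω).subtypeL (H10 Ω).subtypeL
  have hco : IsCoercive B := ⟨κ, hκ, fun p => by
    have := hB p.1 p.2 c hc h0
    simpa [B, sq, mul_assoc] using this⟩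
  let ℓ : H10 Ω →L[ℝ] ℝ :=
    (innerSL ℝ (fn f)).comp ((WithLp.fstL 2 ℝ _ _).comp (H10 Ω).subtypeL)
  let e := hco.continuousLinearEquivOfBilin
  let r := (InnerProductSpace.toDual ℝ (H10 Ω)).symm ℓ
  refine ⟨e.symm r, fun z => ?_⟩
  -- Lax–Milgram produces the solution in the first slot; symmetry moves it there.
  rw [weightForm_comm]
  have h1 := hco.continuousLinearEquivOfBilin_apply (e.symm r) z
  change inner ℝ (e (e.symm r)) z = weightForm hc (e.symm r) z at h1
  rw [← h1, e.apply_symm_apply, InnerProductSpace.toDual_symm_apply]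
  change inner ℝ (fn f) (fn z) = _
  rw [L2.inner_def, l2Form]
  simp

/-! ### The adaptive form and its Green's function -/

theorem l2Form_eq_inner (z w : H10 Ω) : l2Form z w = inner ℝ (fn z) (fn w) := by
  rw [L2.inner_def, l2Form]
  simp [mul_comm]

theorem l2Norm_eq_norm (z : H10 Ω) : l2Norm z = ‖fn z‖ := by
  rw [l2Norm, l2Form_eq_inner, real_inner_self_eq_norm_sq, Real.sqrt_sq (norm_nonneg _)]

/-- The weight `V + β |u|²` of the form `auForm`. -/
def auWeight (V : Euc d → ℝ) (β : ℝ) (u : H10 Ω) (x : Euc d) : ℝ := V x + β * |fn u x| ^ 2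

theorem memLp_top_of_mem_manifold {u : H10 Ω} (hu : u ∈ manifold Ω M₀) :
    MemLp (fn u) ⊤ (volume.restrict Ω) :=
  memLp_top_of_bound (Lp.aestronglyMeasurable _) M₀ (by simpa using hu.2)

theorem memLp_top_mul {f g : Euc d → ℝ} (hf : MemLp f ⊤ (volume.restrict Ω))
    (hg : MemLp g ⊤ (volume.restrict Ω)) :
    MemLp (fun x => f x * g x) ⊤ (volume.restrict Ω) := hg.mul hf

theorem memLp_auWeight (hV : MemLp V ⊤ (volume.restrict Ω)) {u : H10 Ω}
    (hu : MemLp (fn u) ⊤ (volume.restrict Ω)) :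
    MemLp (auWeight V β u) ⊤ (volume.restrict Ω) := by
  have h := hV.add ((memLp_top_mul hu hu).const_mul β)
  refine h.ae_eq (Filter.Eventually.of_forall fun x => ?_)
  simp [auWeight, sq]

theorem auWeight_nonneg (hadm : Admissible d Ω V β) (u : H10 Ω) :
    ∀ᵐ x ∂volume.restrict Ω, 0 ≤ auWeight V β u x := by
  filter_upwards [hadm.potential_nonneg] with x hx
  have := hadm.beta_nonneg
  unfold auWeight
  positivity

theorem auForm_eq_weightForm {u : H10 Ω} (hc : MemLp (auWeight V β u) ⊤ (volume.restrict Ω))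
    (z w : H10 Ω) : auForm V β u z w = weightForm hc z w := by
  rw [weightForm_apply, auForm]
  refine integral_congr_ae (Filter.Eventually.of_forall fun x => ?_)
  simp only [auWeight, fn, wgrad]
  ring

theorem a0Form_le_auForm (hadm : Admissible d Ω V β) {u : H10 Ω}
    (hu : MemLp (fn u) ⊤ (volume.restrict Ω)) (z : H10 Ω) :
    a0Form V z z ≤ auForm V β u z z := by
  have hc := memLp_auWeight (β := β) hadm.potential_memLp hu
  rw [auForm_eq_weightForm hc, weightForm_apply, a0Form]
  refine integral_mono_ae
    ((L2.integrable_inner _ _).add (integrable_weight_mul hadm.potential_memLp _ _))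
    ((L2.integrable_inner _ _).add (integrable_weight_mul hc _ _))
    (Filter.Eventually.of_forall fun x => ?_)
  have h0 : 0 ≤ β * |fn u x| ^ 2 * (fn z x * fn z x) :=
    mul_nonneg (mul_nonneg hadm.beta_nonneg (by positivity)) (mul_self_nonneg _)
  change inner ℝ (wgrad z x) (wgrad z x) + V x * fn z x * fn z x
    ≤ inner ℝ (wgrad z x) (wgrad z x) + auWeight V β u x * fn z x * fn z x
  simp only [auWeight]
  nlinarith

theorem isGreen_green (hadm : Admissible d Ω V β) {u : H10 Ω}
    (hu : MemLp (fn u) ⊤ (volume.restrict Ω)) (w : H10 Ω) :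
    IsGreen V β u w (green V β u w) := by
  have hc := memLp_auWeight (β := β) hadm.potential_memLp hu
  obtain ⟨y, hy⟩ := exists_weightForm_eq_inner hadm hc (auWeight_nonneg hadm u) w
  exact Classical.epsilon_spec ⟨y, fun z => (auForm_eq_weightForm hc z y).trans (hy z)⟩

/-! ### The Sobolev gradient -/

theorem fn_add_smul (u w : H10 Ω) (t : ℝ) :
    fn (u + t • w) =ᵐ[volume.restrict Ω] fun x => fn u x + t * fn w x := by
  have e : fn (u + t • w) = fn u + t • fn w := rfl
  rw [e]
  filter_upwards [Lp.coeFn_add (fn u) (t • fn w), Lp.coeFn_smul t (fn w)] with x h1 h2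
  exact h1.trans (congrArg (fn u x + ·) h2)

theorem wgrad_add_smul (u w : H10 Ω) (t : ℝ) :
    wgrad (u + t • w) =ᵐ[volume.restrict Ω] fun x => wgrad u x + t • wgrad w x := by
  have e : wgrad (u + t • w) = wgrad u + t • wgrad w := rfl
  rw [e]
  filter_upwards [Lp.coeFn_add (wgrad u) (t • wgrad w), Lp.coeFn_smul t (wgrad w)] with x h1 h2
  exact h1.trans (congrArg (wgrad u x + ·) h2)

/-- The energy along a line is a quartic polynomial in `t`, so no differentiation under the integral
sign is needed. -/
theorem hasDerivAt_integral_quartic {α : Type*} [MeasurableSpace α] {μ : Measure α}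
    {f₀ f₁ f₂ f₃ f₄ : α → ℝ} (h₀ : Integrable f₀ μ) (h₁ : Integrable f₁ μ) (h₂ : Integrable f₂ μ)
    (h₃ : Integrable f₃ μ) (h₄ : Integrable f₄ μ) :
    HasDerivAt (fun t : ℝ => ∫ x, (f₀ x + t * f₁ x + t ^ 2 * f₂ x + t ^ 3 * f₃ x + t ^ 4 * f₄ x) ∂μ)
      (∫ x, f₁ x ∂μ) 0 := by
  have e : (fun t : ℝ =>
      ∫ x, (f₀ x + t * f₁ x + t ^ 2 * f₂ x + t ^ 3 * f₃ x + t ^ 4 * f₄ x) ∂μ) = fun t =>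
      (∫ x, f₀ x ∂μ) + t * (∫ x, f₁ x ∂μ) + t ^ 2 * (∫ x, f₂ x ∂μ) + t ^ 3 * (∫ x, f₃ x ∂μ)
        + t ^ 4 * ∫ x, f₄ x ∂μ := by
    funext t
    have a1 := h₀.add (h₁.const_mul t)
    have a2 := a1.add (h₂.const_mul (t ^ 2))
    have a3 := a2.add (h₃.const_mul (t ^ 3))
    simp only [Pi.add_def] at a1 a2 a3
    rw [integral_add a3 (h₄.const_mul _), integral_add a2 (h₃.const_mul _),
      integral_add a1 (h₂.const_mul _), integral_add h₀ (h₁.const_mul _)]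
    simp only [integral_const_mul]
  rw [e]
  have hid := hasDerivAt_id' (0 : ℝ)
  have := ((((hid.mul_const (∫ x, f₁ x ∂μ)).const_add (∫ x, f₀ x ∂μ)).add
    ((hid.pow 2).mul_const (∫ x, f₂ x ∂μ))).add ((hid.pow 3).mul_const (∫ x, f₃ x ∂μ))).add
    ((hid.pow 4).mul_const (∫ x, f₄ x ∂μ))
  exact this.congr_deriv (by simp)

theorem isSobolevGrad_self (hadm : Admissible d Ω V β) {u : H10 Ω}
    (hu : MemLp (fn u) ⊤ (volume.restrict Ω)) : IsSobolevGrad V β u u := by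
  intro w hw
  have hV := hadm.potential_memLp
  have I : ∀ z y : H10 Ω, Integrable (fun x => inner ℝ (wgrad z x) (wgrad y x))
    (volume.restrict Ω) := fun z y => L2.integrable_inner _ _
  have J := fun (c : Euc d → ℝ) (hc : MemLp c ⊤ (volume.restrict Ω)) (z y : H10 Ω) =>
    integrable_weight_mul hc (fn z) (fn y)
  have huu := memLp_top_mul hu hu
  have huw := memLp_top_mul hu hw
  have hww := memLp_top_mul hw hw
  have h3 : Integrable (fun x => β * |fn u x| ^ 2 * fn u x * fn w x) (volume.restrict Ω) := by
    refine ((J _ huu u w).const_mul β).congr (Filter.Eventually.of_forall fun x => ?_)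
    simp only [sq_abs]
    ring
  have key := hasDerivAt_integral_quartic
    (((I u u).add (J V hV u u)).add ((J _ huu u u).const_mul (β / 2)))
    ((((I u w).add (J V hV u w)).add h3).const_mul 2)
    (((I w w).add (J V hV w w)).add ((J _ huu w w).const_mul (3 * β)))
    ((J _ huw w w).const_mul (2 * β)) ((J _ hww w w).const_mul (β / 2))
  rw [integral_const_mul] at key
  refine key.congr_of_eventuallyEq (Filter.Eventually.of_forall fun t => ?_)
  refine integral_congr_ae ?_
  filter_upwards [fn_add_smul u w t, wgrad_add_smul u w t] with x h1 h2
  have h4 : |fn u x + t * fn w x| ^ 4 = (fn u x + t * fn w x) ^ 4 :=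
    Even.pow_abs (by decide) _
  rw [h1, h2, ← real_inner_self_eq_norm_sq, h4, sq_abs]
  simp only [Pi.add_apply, sq_abs, inner_add_left, inner_add_right,
    real_inner_smul_left, real_inner_smul_right, real_inner_comm (wgrad u x) (wgrad w x)]
  ring

/-- Derivatives are unique, so the chosen gradient and `u` have the same `a_u`-pairing with every
bounded direction. Test functions are such directions and are dense, so coercivity forces equality.
-/
theorem sobolevGrad_eq_self (hadm : Admissible d Ω V β) {u : H10 Ω}
    (hu : MemLp (fn u) ⊤ (volume.restrict Ω)) : sobolevGrad V β u = u := by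
  have h1 := isSobolevGrad_self hadm hu
  have h2 : IsSobolevGrad V β u (sobolevGrad V β u) := Classical.epsilon_spec ⟨u, h1⟩
  set g := sobolevGrad V β u
  have hc := memLp_auWeight (β := β) hadm.potential_memLp hu
  obtain ⟨κ, hκ, hB⟩ := exists_coercive hadm
  have key : ∀ p ∈ H10 Ω, weightForm hc (g - u : H10 Ω) p = 0 := by
    intro p hp
    refine closure_minimal (s := testPairs Ω)
      (t := {p : L2Pair Ω | weightForm hc (g - u : H10 Ω) p = 0}) ?_
      (isClosed_eq (weightForm hc _).continuous continuous_const) hp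
    intro q hq
    obtain ⟨w, rfl⟩ : ∃ w : H10 Ω, (w : L2Pair Ω) = q :=
      ⟨⟨q, (testPairs Ω).le_topologicalClosure hq⟩, rfl⟩
    obtain ⟨φ, ⟨s1, s2, -⟩, e1, -⟩ := hq
    have hw : MemLp (fn w) ⊤ (volume.restrict Ω) :=
      (s1.continuous.memLp_of_hasCompactSupport s2).ae_eq e1.symm
    have := (h2 w hw).unique (h1 w hw)
    rw [auForm_eq_weightForm hc, auForm_eq_weightForm hc] at this
    change weightForm hc ((g : L2Pair Ω) - u) w = 0
    rw [map_sub, _root_.sub_apply]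
    linarith
  have h3 := hB _ (g - u).2 _ hc (auWeight_nonneg hadm u)
  rw [key _ (g - u).2] at h3
  have h4 : ‖((g - u : H10 Ω) : L2Pair Ω)‖ = 0 := by
    by_contra h
    have : 0 < ‖((g - u : H10 Ω) : L2Pair Ω)‖ ^ 2 := by positivity
    nlinarith
  exact sub_eq_zero.1 (Subtype.ext (norm_eq_zero.1 h4))

/-! ### Comparison of the energy with the adaptive form -/

/-- The integrands differ by `(β/2)(w² - u²)² = (β/2)(w + u)²(w - u)²`, and `|w + u| ≤ 2M₀` almost
everywhere. -/
theorem energy_sub_le (hadm : Admissible d Ω V β) {u w : H10 Ω} (hu : u ∈ manifold Ω M₀)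
    (hw : w ∈ manifold Ω M₀) :
    energy V β w - energy V β u ≤ auForm V β u w w - auForm V β u u u
      + 2 * β * M₀ ^ 2 * l2Form (w - u) (w - u) := by
  have hu' := memLp_top_of_mem_manifold hu
  have hw' := memLp_top_of_mem_manifold hw
  have hV := hadm.potential_memLp
  have hβ := hadm.beta_nonneg
  have I : ∀ z : H10 Ω, Integrable (fun x => ‖wgrad z x‖ ^ 2) (volume.restrict Ω) :=
    fun z => (Lp.memLp _).integrable_norm_pow (by norm_num)
  have J := fun (c : Euc d → ℝ) (hc : MemLp c ⊤ (volume.restrict Ω)) (z y : H10 Ω) =>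
    integrable_weight_mul hc (fn z) (fn y)
  have hE : ∀ z : H10 Ω, MemLp (fn z) ⊤ (volume.restrict Ω) →
      Integrable (fun x => ‖wgrad z x‖ ^ 2 + V x * |fn z x| ^ 2 + β / 2 * |fn z x| ^ 4)
        (volume.restrict Ω) := by
    intro z hz
    refine (((I z).add (J V hV z z)).add ((J _ (memLp_top_mul hz hz) z z).const_mul (β / 2))).congr
      (Filter.Eventually.of_forall fun x => ?_)
    have h4 : |fn z x| ^ 4 = (fn z x) ^ 4 := Even.pow_abs (by decide) _
    simp only [Pi.add_apply, h4, sq_abs]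
    ring
  have hA : ∀ z : H10 Ω, Integrable (fun x => inner ℝ (wgrad z x) (wgrad z x)
      + V x * fn z x * fn z x + β * |fn u x| ^ 2 * fn z x * fn z x) (volume.restrict Ω) := by
    intro z
    refine ((L2.integrable_inner _ _).add (J V hV z z)).add
      (((J _ (memLp_top_mul hu' hu') z z).const_mul β).congr
        (Filter.Eventually.of_forall fun x => ?_))
    simp only [sq_abs]
    ring
  have hL : Integrable (fun x => fn (w - u) x * fn (w - u) x) (volume.restrict Ω) :=
    (Lp.memLp _).integrable_mul (Lp.memLp _)
  have hAA := (hA w).sub (hA u)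
  simp only [Pi.sub_def] at hAA
  rw [energy, energy, auForm, auForm, l2Form, ← integral_const_mul,
    ← integral_sub (hE w hw') (hE u hu'), ← integral_sub (hA w) (hA u),
    ← integral_add hAA (hL.const_mul _)]
  refine integral_mono_ae ((hE w hw').sub (hE u hu'))
    (hAA.add (hL.const_mul _)) ?_
  have e : fn (w - u) = fn w - fn u := rfl
  filter_upwards [hu.2, hw.2, Lp.coeFn_sub (fn w) (fn u)] with x b1 b2 b3
  rw [← e] at b3
  have h4 : ∀ s : ℝ, |s| ^ 4 = s ^ 4 := fun s => Even.pow_abs (by decide) s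
  have b4 : (fn w x + fn u x) ^ 2 ≤ (2 * M₀) ^ 2 := by
    refine sq_le_sq' ?_ ?_ <;> linarith [abs_le.1 b1, abs_le.1 b2]
  have b5 := mul_le_mul_of_nonneg_left b4
    (mul_nonneg (half_pos one_pos).le (mul_nonneg hβ (sq_nonneg (fn w x - fn u x))))
  simp only [b3, Pi.sub_apply, h4, sq_abs, real_inner_self_eq_norm_sq]
  nlinarith

/-! ### Orthogonality of the manifold gradient -/

/-- By coercivity `y` would vanish, contradicting `(u, y)_{a_u} = (u, u)_{L²} = 1`. -/
theorem auForm_green_ne_zero (hadm : Admissible d Ω V β) {u y : H10 Ω}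
    (hb : MemLp (fn u) ⊤ (volume.restrict Ω)) (huu : l2Form u u = 1)
    (hy : IsGreen V β u u y) : auForm V β u y y ≠ 0 := by
  intro h0
  have hc := memLp_auWeight (β := β) hadm.potential_memLp hb
  obtain ⟨κ, hκ, hB⟩ := exists_coercive hadm
  have h1 := hB _ y.2 _ hc (auWeight_nonneg hadm u)
  rw [← auForm_eq_weightForm hc, h0] at h1
  have h2 : ‖(y : L2Pair Ω)‖ = 0 := by
    by_contra h
    have : 0 < ‖(y : L2Pair Ω)‖ ^ 2 := by positivity
    nlinarith
  have h3 := hy u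
  rw [auForm_eq_weightForm hc, norm_eq_zero.1 h2, map_zero, huu] at h3
  exact zero_ne_one h3

theorem manifoldGrad_eq (hadm : Admissible d Ω V β) {u : H10 Ω}
    (hb : MemLp (fn u) ⊤ (volume.restrict Ω)) (huu : l2Form u u = 1) :
    manifoldGrad V β u
      = u - (auForm V β u (green V β u u) (green V β u u))⁻¹ • green V β u u := by
  rw [manifoldGrad, tangentProj, sobolevGrad_eq_self hadm hb, huu, one_div]

theorem l2Form_sub_smul_green {u y g : H10 Ω} {α : ℝ} (hα : α ≠ 0) (huu : l2Form u u = 1)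
    (hyu : l2Form y u = α) (hg : g = u - α⁻¹ • y) : l2Form u g = 0 := by
  have e : fn g = fn u - α⁻¹ • fn y := by subst hg; rfl
  rw [l2Form_eq_inner, real_inner_comm] at hyu
  rw [l2Form_eq_inner] at huu
  rw [l2Form_eq_inner, e, inner_sub_right, real_inner_smul_right, huu, hyu,
    inv_mul_cancel₀ hα, sub_self]

/-- The Green identity turns `L²`-orthogonality to `u` into `a_u`-orthogonality of `g` to `y`, and
`u - g` is a multiple of `y`. -/
theorem auForm_sub_smul_green {u y g : H10 Ω} {α : ℝ}
    (hc : MemLp (auWeight V β u) ⊤ (volume.restrict Ω)) (hy : IsGreen V β u u y)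
    (h0 : l2Form u g = 0) (hg : g = u - α⁻¹ • y) :
    weightForm hc (u : L2Pair Ω) g = weightForm hc (g : L2Pair Ω) g := by
  have h1 : weightForm hc (y : L2Pair Ω) g = 0 := by
    rw [weightForm_comm, ← auForm_eq_weightForm hc, hy g, l2Form_eq_inner, real_inner_comm,
      ← l2Form_eq_inner, h0]
  have e : (g : L2Pair Ω) = u - α⁻¹ • (y : L2Pair Ω) := congrArg Subtype.val hg
  have h2 : weightForm hc ((u : L2Pair Ω) - α⁻¹ • (y : L2Pair Ω)) g
      = weightForm hc (u : L2Pair Ω) g := by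
    rw [map_sub, map_smul, _root_.sub_apply, _root_.smul_apply, h1, smul_zero, sub_zero]
  rw [← h2, ← e]

theorem manifoldGrad_orthogonality (hadm : Admissible d Ω V β) {u : H10 Ω}
    (hb : MemLp (fn u) ⊤ (volume.restrict Ω)) (huu : l2Form u u = 1)
    (hc : MemLp (auWeight V β u) ⊤ (volume.restrict Ω)) :
    l2Form u (manifoldGrad V β u) = 0 ∧
      weightForm hc (u : L2Pair Ω) (manifoldGrad V β u)
        = weightForm hc (manifoldGrad V β u : L2Pair Ω) (manifoldGrad V β u) := by
  have hy := isGreen_green hadm hb u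
  have hg := manifoldGrad_eq hadm hb huu
  have h0 := l2Form_sub_smul_green (auForm_green_ne_zero hadm hb huu hy) huu
    (hy (green V β u u)).symm hg
  exact ⟨h0, auForm_sub_smul_green hc hy h0 hg⟩

/-! ### The retraction step and the descent estimate -/

theorem bilin_retraction_step {E : Type*} [NormedAddCommGroup E] [NormedSpace ℝ E]
    (B : E →L[ℝ] E →L[ℝ] ℝ) {u g : E} {a b N τ : ℝ} (huu : B u u = a) (hug : B u g = b)
    (hgu : B g u = b) (hgg : B g g = b) (hN : N ≠ 0) :
    B (N⁻¹ • (u - τ • g)) (N⁻¹ • (u - τ • g)) = (a - 2 * τ * b + τ ^ 2 * b) / N ^ 2 ∧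
      B (u - N⁻¹ • (u - τ • g)) (u - N⁻¹ • (u - τ • g))
        = ((N - 1) ^ 2 * a + 2 * (N - 1) * τ * b + τ ^ 2 * b) / N ^ 2 := by
  constructor <;>
  · simp only [map_sub, map_smul, _root_.sub_apply, _root_.smul_apply, smul_eq_mul, huu, hug,
      hgu, hgg]
    field_simp
    ring

theorem bilin_sub_self {E : Type*} [NormedAddCommGroup E] [NormedSpace ℝ E]
    (B : E →L[ℝ] E →L[ℝ] ℝ) {u g : E} {a b : ℝ} (huu : B u u = a) (hug : B u g = b)
    (hgu : B g u = b) (hgg : B g g = b) : B (u - g) (u - g) = a - b := by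
  simp only [map_sub, _root_.sub_apply, huu, hug, hgu, hgg]
  ring

theorem norm_sub_smul_sq_of_inner_eq_zero {E : Type*} [NormedAddCommGroup E]
    [InnerProductSpace ℝ E] {u g : E} (hu : ‖u‖ = 1) (hug : inner ℝ u g = 0) (τ : ℝ) :
    ‖u - τ • g‖ ^ 2 = 1 + τ ^ 2 * ‖g‖ ^ 2 := by
  rw [norm_sub_sq_real, real_inner_smul_right, hug, hu, norm_smul, mul_pow, Real.norm_eq_abs,
    sq_abs]
  ring

theorem norm_retraction_sub_sq {E : Type*} [NormedAddCommGroup E] [InnerProductSpace ℝ E]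
    {u g : E} (hu : ‖u‖ = 1) (hug : inner ℝ u g = 0) {τ N : ℝ} (hN : ‖u - τ • g‖ = N)
    (hN0 : 0 < N) : ‖N⁻¹ • (u - τ • g) - u‖ ^ 2 = 2 - 2 / N := by
  have h : inner ℝ (N⁻¹ • (u - τ • g)) u = N⁻¹ := by
    rw [real_inner_smul_left, inner_sub_left, real_inner_smul_left, real_inner_comm u g, hug,
      real_inner_self_eq_norm_sq, hu]
    ring
  rw [norm_sub_sq_real, h, hu, norm_smul, hN, norm_inv, Real.norm_of_nonneg hN0.le,
    inv_mul_cancel₀ hN0.ne']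
  ring

/-- After multiplication by `N²`, the left side is at most `(3/4)τ²lA² + (1/2)τG²`, while the
step-size bound leaves a decrease of at least `τ²lA² + τG²`. Here `l = ‖g‖²_{L²}` and `K = βM₀²`. -/
theorem descent_inequality {A G l N τ K C D : ℝ} (hG : 0 ≤ G) (hGA : G ≤ A)
    (hl0 : 0 ≤ l) (hl : l ≤ C * G ^ 2) (hK : 0 ≤ K) (hC : 0 ≤ C) (hτ : 0 < τ)
    (hτC : τ * (1 + 4 * K * C) ≤ 1) (hN : 1 ≤ N) (hN2 : N ^ 2 = 1 + τ ^ 2 * l)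
    (hD : A ^ 2 - (A ^ 2 - 2 * τ * G ^ 2 + τ ^ 2 * G ^ 2) / N ^ 2 - 2 * K * (2 - 2 / N) ≤ D) :
    1 / 2 * G * (((N - 1) * A + τ * G) / N) ≤ D := by
  refine le_trans ?_ hD
  have hN0 : 0 < N := by linarith
  have hA : 0 ≤ A := hG.trans hGA
  have hτ1 : τ ≤ 1 := by
    have : 0 ≤ τ * (4 * K * C) := by positivity
    linarith
  have e : A ^ 2 - (A ^ 2 - 2 * τ * G ^ 2 + τ ^ 2 * G ^ 2) / N ^ 2 - 2 * K * (2 - 2 / N)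
      = (N ^ 2 * A ^ 2 - A ^ 2 + 2 * τ * G ^ 2 - τ ^ 2 * G ^ 2 - 4 * K * (N * (N - 1)))
        / N ^ 2 := by
    field_simp
    ring
  have e' : 1 / 2 * G * (((N - 1) * A + τ * G) / N)
      = 1 / 2 * (N * (N - 1) * (A * G) + N * (τ * G ^ 2)) / N ^ 2 := by
    field_simp
  rw [e, e']
  refine div_le_div_of_nonneg_right ?_ (by positivity)
  -- For `N ≥ 1`, `N(N - 1) ≤ N² - 1`.
  have hNN : N * (N - 1) ≤ τ ^ 2 * l := by nlinarith
  have hAG : A * G ≤ A ^ 2 := by nlinarith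
  have hG2 : G ^ 2 ≤ A ^ 2 := by nlinarith
  have b1 : N * (N - 1) * (A * G) ≤ τ ^ 2 * l * A ^ 2 := by gcongr
  -- `N ≤ (1 + N²)/2 = 1 + τ²l/2`.
  have b2 : N * (τ * G ^ 2) ≤ (1 + τ ^ 2 * l / 2) * (τ * G ^ 2) := by
    gcongr
    nlinarith [sq_nonneg (N - 1)]
  have b3 : τ ^ 2 * l / 2 * (τ * G ^ 2) ≤ τ ^ 2 * l / 2 * (1 * A ^ 2) := by gcongr
  have b4 : 4 * K * (N * (N - 1)) ≤ 4 * K * (τ ^ 2 * (C * G ^ 2)) := by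
    exact mul_le_mul_of_nonneg_left (hNN.trans (mul_le_mul_of_nonneg_left hl (sq_nonneg τ)))
      (by positivity)
  have b5 : τ * (1 + 4 * K * C) * (τ * G ^ 2) ≤ 1 * (τ * G ^ 2) := by gcongr
  have b6 : N ^ 2 * A ^ 2 = A ^ 2 + τ ^ 2 * l * A ^ 2 := by rw [hN2]; ring
  have b7 : 0 ≤ τ ^ 2 * l * A ^ 2 := by positivity
  have b8 : 0 ≤ τ * G ^ 2 := by positivity
  linarith

set_option maxHeartbeats 1600000 in
theorem retraction_descent (hadm : Admissible d Ω V β) {C : ℝ} (hC : 0 < C)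
    (hP : ∀ p ∈ H10 Ω, ‖p.fst‖ ^ 2 ≤ C * ‖p.snd‖ ^ 2) {u g w : H10 Ω} (hu : u ∈ manifold Ω M₀)
    {τ : ℝ} (hτ : 0 < τ) (hτC : τ * (1 + 4 * (β * M₀ ^ 2) * C) ≤ 1)
    (hc : MemLp (auWeight V β u) ⊤ (volume.restrict Ω))
    (ho : l2Form u g = 0)
    (hag : weightForm hc (u : L2Pair Ω) g = weightForm hc (g : L2Pair Ω) g)
    (hwg : w = retraction (u - τ • g)) (hw : w ∈ manifold Ω M₀) :
    1 / 2 * auNorm V β u g * a0Norm V (u - w) ≤ energy V β u - energy V β w := by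
  have hb := memLp_top_of_mem_manifold hu
  have h0 := auWeight_nonneg hadm u
  have hpos : ∀ p : L2Pair Ω, 0 ≤ weightForm hc p p := fun p =>
    (sq_nonneg _).trans (norm_snd_sq_le_weightForm hc h0 p)
  have hE := energy_sub_le hadm hu hw
  have ha0 := a0Form_le_auForm hadm hb (u - w)
  have huu : ‖fn u‖ = 1 := by rw [← l2Norm_eq_norm]; exact hu.1
  obtain ⟨N, hNdef⟩ : ∃ N, l2Norm (u - τ • g) = N := ⟨_, rfl⟩
  have hwN : w = N⁻¹ • (u - τ • g) := by rw [hwg, retraction, hNdef]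
  rw [l2Form_eq_inner] at ho
  have hfv : ‖fn u - τ • fn g‖ = N := by rw [← hNdef, l2Norm_eq_norm]; rfl
  have hN2 : N ^ 2 = 1 + τ ^ 2 * ‖fn g‖ ^ 2 := by
    rw [← hfv, norm_sub_smul_sq_of_inner_eq_zero huu ho]
  have hN : 1 ≤ N := by
    have h1 : 0 ≤ N := by rw [← hfv]; exact norm_nonneg _
    have h2 : 0 ≤ τ ^ 2 * ‖fn g‖ ^ 2 := by positivity
    nlinarith
  have hN0 : 0 < N := by linarith
  have hN1 := sub_nonneg.2 hN
  rw [auForm_eq_weightForm hc, auForm_eq_weightForm hc] at hE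
  rw [auForm_eq_weightForm hc] at ha0
  have hGdef : auNorm V β u g = Real.sqrt (weightForm hc (g : L2Pair Ω) g) := by
    rw [auNorm, auForm_eq_weightForm hc]
  obtain ⟨A, hA0, hA2⟩ : ∃ A, 0 ≤ A ∧ weightForm hc (u : L2Pair Ω) u = A ^ 2 :=
    ⟨_, Real.sqrt_nonneg _, (Real.sq_sqrt (hpos _)).symm⟩
  obtain ⟨G, hG0, hGn, hG2⟩ : ∃ G, 0 ≤ G ∧ auNorm V β u g = G ∧
      weightForm hc (g : L2Pair Ω) g = G ^ 2 :=
    ⟨_, Real.sqrt_nonneg _, hGdef, (Real.sq_sqrt (hpos _)).symm⟩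
  rw [hG2] at hag
  have hga : weightForm hc (g : L2Pair Ω) u = G ^ 2 := by rw [weightForm_comm, hag]
  have hGA : G ≤ A := by
    -- Pythagoras: `‖u - g‖²_{a_u} = A² - G²`.
    have h1 := hpos ((u : L2Pair Ω) - g)
    rw [bilin_sub_self (weightForm hc) hA2 hag hga hG2] at h1
    exact (sq_le_sq₀ hG0 hA0).1 (by linarith)
  have hwc : (w : L2Pair Ω) = N⁻¹ • ((u : L2Pair Ω) - τ • (g : L2Pair Ω)) := by
    rw [hwN, Submodule.coe_smul, Submodule.coe_sub, Submodule.coe_smul]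
  obtain ⟨hww, huw⟩ := bilin_retraction_step (weightForm hc) (τ := τ) hA2 hag hga hG2
    hN0.ne'
  rw [← hwc] at hww huw
  have hdist : l2Form (w - u) (w - u) = 2 - 2 / N := by
    have h1 : fn (w - u) = N⁻¹ • (fn u - τ • fn g) - fn u := by rw [hwN]; rfl
    rw [l2Form_eq_inner, real_inner_self_eq_norm_sq, h1, norm_retraction_sub_sq huu ho hfv hN0]
  have hdn : a0Norm V (u - w) ≤ ((N - 1) * A + τ * G) / N := by
    refine Real.sqrt_le_iff.2 ⟨by positivity, ha0.trans ?_⟩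
    refine huw.le.trans ?_
    rw [div_pow]
    refine div_le_div_of_nonneg_right ?_ (by positivity)
    -- Replacing `G²` by `AG` in the cross term completes the square `((N - 1)A + τG)²`.
    have h1 : (N - 1) * τ * (G * G) ≤ (N - 1) * τ * (A * G) := by gcongr
    linarith [h1]
  have hl : ‖fn g‖ ^ 2 ≤ C * G ^ 2 := by
    refine (hP g g.2).trans ?_
    rw [← hG2]
    exact mul_le_mul_of_nonneg_left (norm_snd_sq_le_weightForm hc h0 g) hC.le
  have hK : 0 ≤ β * M₀ ^ 2 := mul_nonneg hadm.beta_nonneg (sq_nonneg _)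
  rw [hGn]
  refine (mul_le_mul_of_nonneg_left hdn (by positivity)).trans
    (descent_inequality hG0 hGA (sq_nonneg _) hl hK hC.le hτ hτC hN hN2 ?_)
  rw [hww, hdist, hA2] at hE
  linarith

theorem pgdStep_descent (hadm : Admissible d Ω V β) {C : ℝ} (hC : 0 < C)
    (hP : ∀ p ∈ H10 Ω, ‖p.fst‖ ^ 2 ≤ C * ‖p.snd‖ ^ 2) {u : H10 Ω} (hu : u ∈ manifold Ω M₀)
    {τ : ℝ} (hτ : 0 < τ) (hτC : τ * (1 + 4 * (β * M₀ ^ 2) * C) ≤ 1)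
    (hw : pgdStep V β τ u ∈ manifold Ω M₀) :
    1 / 2 * auNorm V β u (manifoldGrad V β u) * a0Norm V (u - pgdStep V β τ u)
      ≤ energy V β u - energy V β (pgdStep V β τ u) := by
  have hb := memLp_top_of_mem_manifold hu
  have hc := memLp_auWeight (β := β) hadm.potential_memLp hb
  have huu : l2Form u u = 1 := Real.sqrt_eq_one.1 hu.1
  obtain ⟨ho, hag⟩ := manifoldGrad_orthogonality hadm hb huu hc
  exact retraction_descent hadm hC hP hu hτ hτC hc ho hag rfl hw

end

end GrossPitaevskii

theorem mainTheorem5 (d : ℕ) (Ω : Set (GrossPitaevskii.Euc d))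
    (V : GrossPitaevskii.Euc d → ℝ) (β M₀ : ℝ)
    (hadm : GrossPitaevskii.Admissible d Ω V β) :
    ∃ τmax > 0, ∃ C_D > 0,
      ∀ (u : ℕ → GrossPitaevskii.H10 Ω) (τ : ℕ → ℝ),
        (∀ n, u n ∈ GrossPitaevskii.manifold Ω M₀) →
        (∀ n, 0 < τ n ∧ τ n ≤ τmax) →
        (∀ n, u (n + 1) = GrossPitaevskii.pgdStep V β (τ n) (u n)) →
        ∀ n,
          GrossPitaevskii.energy V β (u n) - GrossPitaevskii.energy V β (u (n + 1)) ≥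
            C_D * GrossPitaevskii.auNorm V β (u n) (GrossPitaevskii.manifoldGrad V β (u n)) *
              GrossPitaevskii.a0Norm V (u n - u (n + 1)) := by
  obtain ⟨C, hC, hP⟩ := GrossPitaevskii.exists_poincare hadm
  have hβ := hadm.beta_nonneg
  have hpos : 0 < 1 + 4 * (β * M₀ ^ 2) * C := by positivity
  -- With this `τmax`, the second-order losses `τ²G²` and `4βM₀²Cτ²G²` together cost at most `τG²`,
  -- half of the gain `2τG²`.
  refine ⟨(1 + 4 * (β * M₀ ^ 2) * C)⁻¹, inv_pos.2 hpos, 1 / 2, by norm_num, ?_⟩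
  intro u τ hu hτ hstep n
  have hw := hu (n + 1)
  rw [hstep n] at hw ⊢
  refine GrossPitaevskii.pgdStep_descent hadm hC hP (hu n) (hτ n).1 ?_ hw
  have := mul_le_mul_of_nonneg_right (hτ n).2 hpos.le
  rwa [inv_mul_cancel₀ hpos.ne'] at this
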